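/- **Conventions.** A crossed extension of groups is an exact sequence $X\colon 0\to B\xrightarrow{j}G_2\xrightarrow{\partial}G_1\xrightarrow{p}C\to 1$ together with an action of $G_1$ on $G_2$ by automorphisms making $\partial$ a crossed module. Then $B$ is abelian, it is a $C$-module via $j(p(g)\ast b)=g\ast j(b)$, and we put $\Pi(X)=(C,B)$, an object of the category $\mathsf{Mod}(\mathsf{Gp})$ of group modules and equivariant pairs of homomorphisms. A butterfly $\widehat E\colon X\to X'$ is a group $E$ with homomorphisms $\kappa\colon G_2\to E$, $\iota\colon G_2'\to E$, $\delta\colon E\to G_1$, $\gamma\colon E\to G_1'$ such that $\delta\kappa=\partial$, $\gamma\iota=\partial'$, $\gamma\kappa=1$, the pair $(\delta,\iota)$ is a short exact sequence, and $\kappa$, $\iota$ are pre-crossed modules for the actions of $E$ on $G_2$ and $G_2'$ through $\delta$ and $\gamma$. Two butterflies are isomorphic if there is an isomorphism $E\cong E'$ commuting with the four maps. The category $[\mathsf{BExt}](\mathsf{Gp})$ has crossed extensions as objects and isomorphism classes of butterflies as morphisms; the composite of $E\colon X\to X'$ and $E'\colon X'\to X''$ has as its group the quotient of $E\times_{G_1'}E'$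 by the image of $(\iota,\kappa')\colon G_2'\to E\times_{G_1'}E'$. A morphism $(f_1,f_2)\colon X\to X'$ of crossed modules gives the butterfly with group $G_2'\rtimes G_1$ ($G_1$ acting through $f_1$) and $\kappa(x)=(f_2(x)^{-1},\partial x)$, $\iota(y)=(y,1)$, $\delta(y,g)=g$, $\gamma(y,g)=\partial'(y)f_1(g)$; identities are those of identity morphisms. The functor $P\colon[\mathsf{BExt}](\mathsf{Gp})\to\mathsf{Mod}(\mathsf{Gp})$ is $\Pi$ on objects and sends $[\widehat E]$ to the pair $(\varphi_0,\varphi)$ determined by $\varphi_0(p\,\delta(e))=p'\gamma(e)$ and $\kappa(j(b))\,\iota(j'(\varphi(b)))=1$. The fibre of $P$ over a module $M$ consists of the objects $Z$ with $P(Z)=M$ and the morphisms sent by $P$ to $1_M$. Let $X$ and $X'$ be crossed extensions of groups and $\underline\varphi=(\varphi_0,\varphi)\colon\Pi(X)=(C,B)\to\Pi(X')=(C',B')$ a morphism of modules. Let $\underline\varphi^*X'$ be the pullback $$0\to B'\to G_2'\xrightarrow{\langle\partial',1\rangle}G_1'\times_{C'}C\to C\to1$$ of $X'$ along $\varphi_0$,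 with its canonical morphism $w\colon\underline\varphi^*X'\to X'$, and let $\underline\varphi_*X$ be the push forward $$0\to B'\to (B'\times G_2)/\{(\varphi(b),j(b)^{-1}) : b\in B\}\to G_1\to C\to1$$ of $X$ along $\varphi$, where $B'$ is a $C$-module through $\varphi_0$, with its canonical morphism $u\colon X\to\underline\varphi_*X$. Both lie in the fibre of $P$ over $\Pi(\underline\varphi^*X')$. Write $[\mathsf{BExt}]_{\underline\varphi}(X,X')$ for the set of isomorphism classes $[\widehat E]$ of butterflies $X\to X'$ with $P([\widehat E])=\underline\varphi$. **Theorem.** (i) $[\mathsf{BExt}]_{\underline\varphi}(X,X')\neq\emptyset$ if and only if $\underline\varphi^*X'$ and $\underline\varphi_*X$ are isomorphic in the fibre of $P$ over $\Pi(\underline\varphi^*X')$. (ii) If this is the case, $[\mathsf{BExt}]_{\underline\varphi}(X,X')$ is a simply transitive $\Gamma$-set, where $\Gamma$ is the group of automorphisms of $\underline\varphi^*X'$ in the fibre of $P$ over $\Pi(\underline\varphi^*X')$. The action is given by composition on the left: $a\cdot(w\circ g\circ u)=w\circ(a\circ g)\circ u$ for $a\in\Gamma$ and $g\colon\underline\varphi_*X\to\underline\varphi^*X'$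 in the fibre. -/

import Mathlib

open CategoryTheory

universe u

namespace XExt

/-! ### Group modules -/

/-- A group module `(C, B)`: a group `C` together with a `C`-module `B`.  All groups, also the
abelian group `B`, are written multiplicatively. -/
structure GrpMod where
  C : Type u
  B : Type u
  [grpC : Group C]
  [grpB : CommGroup B]
  [act : MulDistribMulAction C B]

attribute [instance] GrpMod.grpC GrpMod.grpB GrpMod.act

/-- Morphisms of group modules: equivariant pairs `(f₀, f)` of group homomorphisms. -/
@[ext]
structure GrpMod.Hom (M N : GrpMod.{u}) where
  f₀ : M.C →* N.C
  f : M.B →* N.B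
  equivariant : ∀ (c : M.C) (b : M.B), f (c • b) = f₀ c • f b

/-- The category `Mod(Gp)` of group modules. -/
instance : Category GrpMod.{u} where
  Hom M N := GrpMod.Hom M N
  id M := ⟨MonoidHom.id _, MonoidHom.id _, fun _ _ => rfl⟩
  comp F G := ⟨G.f₀.comp F.f₀, G.f.comp F.f, fun c b => by
    simp [F.equivariant, G.equivariant]⟩

theorem GrpMod.hom_ext {M N : GrpMod.{u}} {F G : M ⟶ N}
    (h₀ : ∀ c, F.f₀ c = G.f₀ c) (h : ∀ b, F.f b = G.f b) : F = G :=
  GrpMod.Hom.ext (MonoidHom.ext h₀) (MonoidHom.ext h)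

/-- Restriction of a module `M` along a group homomorphism `φ : C → M.C`. -/
def GrpMod.res (M : GrpMod.{u}) {C : Type u} [Group C] (φ : C →* M.C) : GrpMod.{u} :=
  { C := C, B := M.B, act := MulDistribMulAction.compHom M.B φ }

theorem GrpMod.mk_congr {C B : Type u} [Group C] [CommGroup B]
    (a a' : MulDistribMulAction C B) (h : ∀ (c : C) (b : B), a.smul c b = a'.smul c b) :
    GrpMod.mk C B (act := a) = GrpMod.mk C B (act := a') := by
  have : a = a' := by
    apply MulDistribMulAction.ext
    funext c b
    exact h c b
  rw [this]

/-! ### Crossed extensions -/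

/-- A crossed extension of groups: an exact sequence
`1 → B --j--> G₂ --bd--> G₁ --p--> C → 1` with an action of `G₁` on `G₂` by automorphisms that
makes `bd` a crossed module. -/
structure CrossedExt where
  B : Type u
  G₂ : Type u
  G₁ : Type u
  C : Type u
  [grpB : Group B]
  [grp₂ : Group G₂]
  [grp₁ : Group G₁]
  [grpC : Group C]
  [act : MulDistribMulAction G₁ G₂]
  j : B →* G₂
  bd : G₂ →* G₁
  p : G₁ →* C
  /-- `bd` is a pre-crossed module. -/
  bd_smul : ∀ (g : G₁) (x : G₂), bd (g • x) = g * bd x * g⁻¹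
  /-- The Peiffer condition. -/
  peiffer : ∀ x y : G₂, bd x • y = x * y * x⁻¹
  j_injective : Function.Injective j
  exact₂ : j.range = bd.ker
  exact₁ : bd.range = p.ker
  p_surjective : Function.Surjective p

attribute [instance] CrossedExt.grpB CrossedExt.grp₂ CrossedExt.grp₁ CrossedExt.grpC
  CrossedExt.act

namespace CrossedExt

variable (X : CrossedExt.{u})

theorem bd_j (b : X.B) : X.bd (X.j b) = 1 := by
  have : X.j b ∈ X.bd.ker := X.exact₂ ▸ ⟨b, rfl⟩
  exact this

theorem p_bd (x : X.G₂) : X.p (X.bd x) = 1 := by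
  have : X.bd x ∈ X.p.ker := X.exact₁ ▸ ⟨x, rfl⟩
  exact this

theorem exists_j {x : X.G₂} (h : X.bd x = 1) : ∃ b, X.j b = x := by
  have : x ∈ X.j.range := X.exact₂ ▸ h
  exact this

theorem exists_bd {g : X.G₁} (h : X.p g = 1) : ∃ x, X.bd x = g := by
  have : g ∈ X.bd.range := X.exact₁ ▸ h
  exact this

theorem j_comm (b : X.B) (x : X.G₂) : X.j b * x = x * X.j b := by
  have := X.peiffer (X.j b) x
  rw [X.bd_j, one_smul] at this
  exact (eq_mul_inv_iff_mul_eq.1 this).symm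

/-- The kernel `B` of a crossed module is abelian. -/
instance : CommGroup X.B :=
  { X.grpB with
    mul_comm := fun a b => X.j_injective (by rw [map_mul, map_mul, X.j_comm]) }

theorem exists_act (c : X.C) (b : X.B) :
    ∃ b' : X.B, ∀ g : X.G₁, X.p g = c → X.j b' = g • X.j b := by
  obtain ⟨g, hg⟩ := X.p_surjective c
  obtain ⟨b', hb'⟩ := X.exists_j (x := g • X.j b) (by rw [X.bd_smul, X.bd_j]; simp)
  refine ⟨b', fun g' hg' => ?_⟩
  obtain ⟨x, hx⟩ := X.exists_bd (g := g⁻¹ * g') (by simp [hg, hg'])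
  have : g' = g * X.bd x := by rw [hx]; group
  rw [hb', this, mul_smul, X.peiffer, ← X.j_comm]
  simp

/-- The induced action of the cokernel `C` on the kernel `B`: if `p g = c` then `c • b` is the
element with `j (c • b) = g • j b`. -/
noncomputable def actFun (c : X.C) (b : X.B) : X.B := (X.exists_act c b).choose

theorem j_act {c : X.C} {g : X.G₁} (h : X.p g = c) (b : X.B) :
    X.j (X.actFun c b) = g • X.j b :=
  (X.exists_act c b).choose_spec g h

noncomputable instance actCB : MulDistribMulAction X.C X.B where
  smul := X.actFun
  one_smul b := X.j_injective (by
    rw [← one_smul X.G₁ (X.j b)]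
    exact X.j_act (map_one _) b)
  mul_smul c d b := X.j_injective (by
    obtain ⟨g, hg⟩ := X.p_surjective c
    obtain ⟨h, hh⟩ := X.p_surjective d
    refine (X.j_act (g := g * h) (by rw [map_mul, hg, hh]) b).trans ?_
    rw [mul_smul, ← X.j_act hh]
    exact (X.j_act hg _).symm)
  smul_one c := X.j_injective (by
    obtain ⟨g, hg⟩ := X.p_surjective c
    refine (X.j_act hg 1).trans ?_
    simp)
  smul_mul c a b := X.j_injective (by
    obtain ⟨g, hg⟩ := X.p_surjective c
    refine (X.j_act hg (a * b)).trans ?_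
    rw [map_mul, smul_mul', ← X.j_act hg, ← X.j_act hg, ← map_mul]
    rfl)

theorem j_smul (g : X.G₁) (b : X.B) : X.j (X.p g • b) = g • X.j b :=
  X.j_act rfl b

/-- The group module `Π(X) = (C, B)` of a crossed extension. -/
noncomputable abbrev toMod : GrpMod.{u} := { C := X.C, B := X.B }

end CrossedExt

/-- A (strict) morphism of crossed extensions, given by the underlying morphism `(f₁, f₂)` of
crossed modules, which determines the maps on `B` and on `C`. -/
structure StrictHom (X Y : CrossedExt.{u}) where
  f₁ : X.G₁ →* Y.G₁
  f₂ : X.G₂ →* Y.G₂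
  comm : ∀ x, Y.bd (f₂ x) = f₁ (X.bd x)
  equivariant : ∀ (g : X.G₁) (x : X.G₂), f₂ (g • x) = f₁ g • f₂ x

/-- The identity morphism of a crossed extension. -/
def StrictHom.id (X : CrossedExt.{u}) : StrictHom X X where
  f₁ := MonoidHom.id _
  f₂ := MonoidHom.id _
  comm _ := rfl
  equivariant _ _ := rfl

/-! ### Butterflies -/

/-- A butterfly between (the crossed modules underlying) two crossed extensions. -/
structure Butterfly (X Y : CrossedExt.{u}) where
  E : Type u
  [grp : Group E]
  κ : X.G₂ →* E
  ι : Y.G₂ →* E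
  δ : E →* X.G₁
  γ : E →* Y.G₁
  δκ : ∀ h, δ (κ h) = X.bd h
  γι : ∀ g, γ (ι g) = Y.bd g
  /-- `(γ, κ)` is a complex. -/
  γκ : ∀ h, γ (κ h) = 1
  /-- `(δ, ι)` is a short exact sequence. -/
  ι_injective : Function.Injective ι
  δ_surjective : Function.Surjective δ
  exact : ι.range = δ.ker
  /-- `κ` is a pre-crossed module for the action of `E` on `X.G₂` through `δ`. -/
  κ_smul : ∀ (e : E) (h : X.G₂), κ (δ e • h) = e * κ h * e⁻¹
  /-- `ι` is a pre-crossed module for the action of `E` on `Y.G₂` through `γ`. -/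
  ι_smul : ∀ (e : E) (g : Y.G₂), ι (γ e • g) = e * ι g * e⁻¹

attribute [instance] Butterfly.grp

namespace Butterfly

variable {X Y Z W : CrossedExt.{u}}

theorem δι (F : Butterfly X Y) (g : Y.G₂) : F.δ (F.ι g) = 1 := by
  have : F.ι g ∈ F.δ.ker := F.exact ▸ ⟨g, rfl⟩
  exact this

theorem exists_ι (F : Butterfly X Y) {e : F.E} (h : F.δ e = 1) : ∃ g, F.ι g = e := by
  have : e ∈ F.ι.range := F.exact ▸ h
  exact this

/-- Invertible 2-cells of butterflies: two butterflies are isomorphic if there is an isomorphism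
of their central groups that commutes with the `κ`'s, the `ι`'s, the `δ`'s and the `γ`'s. -/
def IsIso (F F' : Butterfly X Y) : Prop :=
  ∃ α : F.E ≃* F'.E, (∀ h, α (F.κ h) = F'.κ h) ∧ (∀ g, α (F.ι g) = F'.ι g) ∧
    (∀ e, F'.δ (α e) = F.δ e) ∧ (∀ e, F'.γ (α e) = F.γ e)

theorem isIso_of_span {F F' : Butterfly X Y} {T : Type*} [Group T] (a : T →* F.E)
    (b : T →* F'.E) (ha : Function.Surjective a) (hk : ∀ t, a t = 1 → b t = 1)
    (hκ : ∀ h, ∃ t, a t = F.κ h ∧ b t = F'.κ h) (hι : ∀ g, ∃ t, a t = F.ι g ∧ b t = F'.ι g)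
    (hδ : ∀ t, F'.δ (b t) = F.δ (a t)) (hγ : ∀ t, F'.γ (b t) = F.γ (a t)) : IsIso F F' := by
  let α : F.E →* F'.E := a.liftOfSurjective ha ⟨b, fun t ht => hk t ht⟩
  have hα : ∀ t, α (a t) = b t := fun t =>
    MonoidHom.liftOfRightInverse_comp_apply a _ (Function.rightInverse_surjInv ha) ⟨b, _⟩ t
  have h1 : ∀ h, α (F.κ h) = F'.κ h := fun h => by
    obtain ⟨t, h1, h2⟩ := hκ h
    rw [← h1, hα, h2]
  have h2 : ∀ h, α (F.ι h) = F'.ι h := fun h => by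
    obtain ⟨t, h1, h2⟩ := hι h
    rw [← h1, hα, h2]
  have h3 : ∀ e, F'.δ (α e) = F.δ e := fun e => by
    obtain ⟨t, rfl⟩ := ha e
    rw [hα, hδ]
  have h4 : ∀ e, F'.γ (α e) = F.γ e := fun e => by
    obtain ⟨t, rfl⟩ := ha e
    rw [hα, hγ]
  have hb : Function.Bijective α := by
    constructor
    · rw [injective_iff_map_eq_one]
      intro e he
      obtain ⟨g, rfl⟩ := F.exists_ι (e := e) (by rw [← h3, he, map_one])
      rw [h2] at he
      rw [F'.ι_injective (he.trans (map_one _).symm), map_one]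
    · intro e'
      obtain ⟨e, he⟩ := F.δ_surjective (F'.δ e')
      obtain ⟨g, hg⟩ := F'.exists_ι (e := e' * (α e)⁻¹) (by simp [h3, he])
      exact ⟨F.ι g * e, by rw [map_mul, h2, hg]; group⟩
  exact ⟨MulEquiv.ofBijective α hb, h1, h2, h3, h4⟩

instance setoid (X Y : CrossedExt.{u}) : Setoid (Butterfly X Y) where
  r := IsIso
  iseqv :=
    { refl := fun F => ⟨MulEquiv.refl _, fun _ => rfl, fun _ => rfl, fun _ => rfl, fun _ => rfl⟩
      symm := fun ⟨α, h1, h2, h3, h4⟩ => ⟨α.symm,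
        fun h => by rw [← h1, MulEquiv.symm_apply_apply],
        fun h => by rw [← h2, MulEquiv.symm_apply_apply],
        fun e => by rw [← h3, MulEquiv.apply_symm_apply],
        fun e => by rw [← h4, MulEquiv.apply_symm_apply]⟩
      trans := fun ⟨α, h1, h2, h3, h4⟩ ⟨β, k1, k2, k3, k4⟩ => ⟨α.trans β,
        fun h => by simp [h1, k1], fun h => by simp [h2, k2],
        fun e => by simp [h3, k3], fun e => by simp [h4, k4]⟩ }

/-- The representable butterfly of a morphism `(f₁, f₂)`.  The group `E` is
the pullback of `f₁` along the domain map of the groupoid `Y.G₂ ⋊ Y.G₁`, that is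
`Y.G₂ ⋊ X.G₁`. -/
def ofHom (f : StrictHom X Y) : Butterfly X Y where
  E := Y.G₂ ⋊[(MulDistribMulAction.toMulAut Y.G₁ Y.G₂).comp f.f₁] X.G₁
  κ :=
    { toFun := fun h => ⟨(f.f₂ h)⁻¹, X.bd h⟩
      map_one' := by ext <;> simp
      map_mul' := fun a b => by
        ext
        · simp [← f.comm, Y.peiffer, mul_assoc]
        · simp }
  ι := SemidirectProduct.inl
  δ := SemidirectProduct.rightHom
  γ :=
    { toFun := fun e => Y.bd e.left * f.f₁ e.right
      map_one' := by simp
      map_mul' := fun a b => by simp [Y.bd_smul, mul_assoc] }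
  δκ _ := rfl
  γι g := by simp
  γκ h := by simp [f.comm]
  ι_injective := SemidirectProduct.inl_injective
  δ_surjective := SemidirectProduct.rightHom_surjective
  exact := SemidirectProduct.range_inl_eq_ker_rightHom
  κ_smul e h := by
    rw [eq_mul_inv_iff_mul_eq]
    refine SemidirectProduct.ext ?_ ?_
    · show (f.f₂ (e.right • h))⁻¹ * (f.f₁ (X.bd (e.right • h)) • e.left) =
        e.left * (f.f₁ e.right • (f.f₂ h)⁻¹)
      rw [← f.comm, Y.peiffer, f.equivariant, smul_inv']
      group
    · show X.bd (e.right • h) * e.right = e.right * X.bd h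
      rw [X.bd_smul]
      group
  ι_smul e g := by
    rw [eq_mul_inv_iff_mul_eq]
    ext
    · simp [mul_smul, Y.peiffer]
    · simp

/-- The fibre product `E ×_{Y.G₁} E'` of `γ` and `δ'`. -/
def fibreProd (F : Butterfly X Y) (F' : Butterfly Y Z) : Subgroup (F.E × F'.E) :=
  (F.γ.comp (MonoidHom.fst F.E F'.E)).eqLocus (F'.δ.comp (MonoidHom.snd F.E F'.E))

theorem fibreProd_eq {F : Butterfly X Y} {F' : Butterfly Y Z} (t : fibreProd F F') :
    F.γ t.1.1 = F'.δ t.1.2 := t.2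

/-- The homomorphism `(ι, κ') : Y.G₂ → E ×_{Y.G₁} E'`. -/
def fibreProdIncl (F : Butterfly X Y) (F' : Butterfly Y Z) : Y.G₂ →* fibreProd F F' :=
  (F.ι.prod F'.κ).codRestrict (fibreProd F F') fun g =>
    show F.γ (F.ι g) = F'.δ (F'.κ g) by rw [F.γι, F'.δκ]

instance (F : Butterfly X Y) (F' : Butterfly Y Z) : (fibreProdIncl F F').range.Normal where
  conj_mem := by
    rintro _ ⟨g, rfl⟩ t
    refine ⟨F.γ t.1.1 • g, ?_⟩
    apply Subtype.ext
    apply Prod.ext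
    · exact F.ι_smul t.1.1 g
    · have := F'.κ_smul t.1.2 g
      rw [← fibreProd_eq] at this
      exact this

theorem fibreProd_incl_fst (F : Butterfly X Y) (F' : Butterfly Y Z) (g : Y.G₂) :
    (fibreProdIncl F F' g).1.1 = F.ι g := rfl

theorem fibreProd_incl_snd (F : Butterfly X Y) (F' : Butterfly Y Z) (g : Y.G₂) :
    (fibreProdIncl F F' g).1.2 = F'.κ g := rfl

theorem mk_eq_one {F : Butterfly X Y} {F' : Butterfly Y Z} (t : fibreProd F F') :
    (QuotientGroup.mk' (fibreProdIncl F F').range t = 1) ↔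
      ∃ g, t.1.1 = F.ι g ∧ t.1.2 = F'.κ g := by
  rw [QuotientGroup.mk'_apply, QuotientGroup.eq_one_iff]
  constructor
  · rintro ⟨g, rfl⟩
    exact ⟨g, rfl, rfl⟩
  · rintro ⟨g, h1, h2⟩
    exact ⟨g, Subtype.ext (Prod.ext h1.symm h2.symm)⟩

/-- The composite of two butterflies (first `F`, then `F'`): its central group is
`E ×_{Y.G₁} E'` modulo the image of `Y.G₂`. -/
def comp (F : Butterfly X Y) (F' : Butterfly Y Z) : Butterfly X Z where
  E := fibreProd F F' ⧸ (fibreProdIncl F F').range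
  κ := (QuotientGroup.mk' _).comp
    ((F.κ.prod (1 : X.G₂ →* F'.E)).codRestrict (fibreProd F F') fun h =>
      show F.γ (F.κ h) = F'.δ 1 by rw [F.γκ, map_one])
  ι := (QuotientGroup.mk' _).comp
    (((1 : Z.G₂ →* F.E).prod F'.ι).codRestrict (fibreProd F F') fun g =>
      show F.γ 1 = F'.δ (F'.ι g) by rw [F'.δι, map_one])
  δ := QuotientGroup.lift _ ((F.δ.comp (MonoidHom.fst _ _)).comp (fibreProd F F').subtype) (by
    rintro _ ⟨g, rfl⟩
    exact F.δι g)
  γ := QuotientGroup.lift _ ((F'.γ.comp (MonoidHom.snd _ _)).comp (fibreProd F F').subtype) (by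
    rintro _ ⟨g, rfl⟩
    exact F'.γκ g)
  δκ h := F.δκ h
  γι g := F'.γι g
  γκ h := map_one F'.γ
  ι_injective := by
    rw [injective_iff_map_eq_one]
    intro g hg
    obtain ⟨y, h1, h2⟩ := (mk_eq_one _).1 hg
    have hy : y = 1 := F.ι_injective (h1.symm.trans (map_one _).symm)
    subst hy
    exact F'.ι_injective (h2.trans ((map_one _).trans (map_one _).symm))
  δ_surjective := by
    intro x
    obtain ⟨e, he⟩ := F.δ_surjective x
    obtain ⟨e', he'⟩ := F'.δ_surjective (F.γ e)
    exact ⟨QuotientGroup.mk' _ ⟨(e, e'), he'.symm⟩, he⟩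
  exact := by
    ext q
    constructor
    · rintro ⟨g, rfl⟩
      exact map_one F.δ
    · obtain ⟨t, rfl⟩ := QuotientGroup.mk'_surjective _ q
      intro h
      obtain ⟨y, hy⟩ := F.exists_ι (e := t.1.1) h
      obtain ⟨z, hz⟩ := F'.exists_ι (e := (F'.κ y)⁻¹ * t.1.2) (by
        rw [map_mul, map_inv, F'.δκ, ← fibreProd_eq, ← hy, F.γι]; simp)
      refine ⟨z, ?_⟩
      refine (QuotientGroup.mk'_eq_mk' _).2 ⟨fibreProdIncl F F' (y), ⟨y, rfl⟩, ?_⟩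
      apply Subtype.ext
      apply Prod.ext
      · show 1 * F.ι y = t.1.1
        rw [hy, one_mul]
      · show F'.ι z * F'.κ y = t.1.2
        have hc : F'.κ y * F'.ι z = F'.ι z * F'.κ y := by
          have := F'.ι_smul (F'.κ y) z
          rw [F'.γκ, one_smul] at this
          exact (eq_mul_inv_iff_mul_eq.1 this).symm
        rw [← hc, hz]
        group
  κ_smul q h := by
    obtain ⟨t, rfl⟩ := QuotientGroup.mk'_surjective _ q
    refine congrArg (QuotientGroup.mk' _) (Subtype.ext (Prod.ext (F.κ_smul t.1.1 h) ?_))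
    show (1 : F'.E) = t.1.2 * 1 * t.1.2⁻¹
    group
  ι_smul q g := by
    obtain ⟨t, rfl⟩ := QuotientGroup.mk'_surjective _ q
    refine congrArg (QuotientGroup.mk' _) (Subtype.ext (Prod.ext ?_ (F'.ι_smul t.1.2 g)))
    show (1 : F.E) = t.1.1 * 1 * t.1.1⁻¹
    group

/-- The class in the composite of a pair in the fibre product. -/
def pair (F : Butterfly X Y) (F' : Butterfly Y Z) : fibreProd F F' →* (comp F F').E :=
  QuotientGroup.mk' _

theorem pair_surjective (F : Butterfly X Y) (F' : Butterfly Y Z) :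
    Function.Surjective (pair F F') := QuotientGroup.mk'_surjective _

theorem pair_eq_one {F : Butterfly X Y} {F' : Butterfly Y Z} (t : fibreProd F F') :
    pair F F' t = 1 ↔ ∃ g, t.1.1 = F.ι g ∧ t.1.2 = F'.κ g := mk_eq_one t

theorem comp_isIso {F G : Butterfly X Y} {F' G' : Butterfly Y Z} (h : IsIso F G)
    (h' : IsIso F' G') : IsIso (comp F F') (comp G G') := by
  obtain ⟨α, h1, h2, h3, h4⟩ := h
  obtain ⟨β, k1, k2, k3, k4⟩ := h'
  let m : fibreProd F F' →* fibreProd G G' :=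
    ((α.toMonoidHom.prodMap β.toMonoidHom).comp (fibreProd F F').subtype).codRestrict _
      fun t => show G.γ (α t.1.1) = G'.δ (β t.1.2) by rw [h4, k3, fibreProd_eq]
  refine isIso_of_span (pair F F') ((pair G G').comp m) (pair_surjective _ _) ?_ ?_ ?_ ?_ ?_
  · intro t ht
    obtain ⟨g, hg, hg'⟩ := (pair_eq_one t).1 ht
    refine (pair_eq_one (m t)).2 ⟨g, ?_, ?_⟩
    · show α t.1.1 = _
      rw [hg, h2]
    · show β t.1.2 = _
      rw [hg', k1]
  · intro x
    refine ⟨⟨(F.κ x, 1), by show F.γ (F.κ x) = F'.δ 1; rw [F.γκ, map_one]⟩, rfl, ?_⟩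
    exact congrArg (pair G G') (Subtype.ext (Prod.ext (h1 x) (map_one β)))
  · intro z
    refine ⟨⟨(1, F'.ι z), by show F.γ 1 = F'.δ (F'.ι z); rw [F'.δι, map_one]⟩, rfl, ?_⟩
    exact congrArg (pair G G') (Subtype.ext (Prod.ext (map_one α) (k2 z)))
  · intro t
    exact h3 t.1.1
  · intro t
    exact k4 t.1.2

theorem id_comp_isIso (F : Butterfly X Y) : IsIso (comp (ofHom (StrictHom.id X)) F) F := by
  let I := ofHom (StrictHom.id X)
  have key : ∀ t : fibreProd I F, X.bd t.1.1.left * t.1.1.right = F.δ t.1.2 := fun t => t.2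
  let m : fibreProd I F →* F.E :=
    { toFun := fun t => (F.κ t.1.1.left)⁻¹ * t.1.2
      map_one' := by
        show (F.κ 1)⁻¹ * 1 = 1
        simp
      map_mul' := fun s t => by
        show (F.κ (s.1.1.left * (s.1.1.right • t.1.1.left)))⁻¹ * (s.1.2 * t.1.2) =
          (F.κ s.1.1.left)⁻¹ * s.1.2 * ((F.κ t.1.1.left)⁻¹ * t.1.2)
        have h1 := F.κ_smul s.1.2 t.1.1.left
        rw [← key, mul_smul, X.peiffer, map_mul, map_mul, map_inv] at h1
        have h2 : F.κ (s.1.1.right • t.1.1.left) =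
            (F.κ s.1.1.left)⁻¹ * (s.1.2 * F.κ t.1.1.left * s.1.2⁻¹) * F.κ s.1.1.left := by
          rw [← h1]; group
        rw [map_mul, h2]
        group }
  refine isIso_of_span (pair I F) m (pair_surjective _ _) ?_ ?_ ?_ ?_ ?_
  · intro t ht
    obtain ⟨g, hg, hg'⟩ := (pair_eq_one t).1 ht
    show (F.κ t.1.1.left)⁻¹ * t.1.2 = 1
    rw [hg, hg']
    show (F.κ g)⁻¹ * F.κ g = 1
    group
  · intro x
    refine ⟨⟨(I.κ x, 1), by show I.γ (I.κ x) = F.δ 1; rw [I.γκ, map_one]⟩, rfl, ?_⟩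
    show (F.κ (x⁻¹))⁻¹ * 1 = F.κ x
    simp
  · intro z
    refine ⟨⟨(1, F.ι z), by show I.γ 1 = F.δ (F.ι z); rw [F.δι, map_one]⟩, rfl, ?_⟩
    show (F.κ 1)⁻¹ * F.ι z = F.ι z
    simp
  · intro t
    show F.δ ((F.κ t.1.1.left)⁻¹ * t.1.2) = t.1.1.right
    rw [map_mul, map_inv, F.δκ, ← key]
    group
  · intro t
    show F.γ ((F.κ t.1.1.left)⁻¹ * t.1.2) = F.γ t.1.2
    rw [map_mul, map_inv, F.γκ]
    group

theorem comp_id_isIso (F : Butterfly X Y) : IsIso (comp F (ofHom (StrictHom.id Y))) F := by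
  let I := ofHom (StrictHom.id Y)
  have key : ∀ t : fibreProd F I, F.γ t.1.1 = t.1.2.right := fun t => t.2
  let m : fibreProd F I →* F.E :=
    { toFun := fun t => F.ι t.1.2.left * t.1.1
      map_one' := by
        show F.ι 1 * 1 = 1
        simp
      map_mul' := fun s t => by
        show F.ι (s.1.2.left * (s.1.2.right • t.1.2.left)) * (s.1.1 * t.1.1) =
          F.ι s.1.2.left * s.1.1 * (F.ι t.1.2.left * t.1.1)
        rw [← key, map_mul, F.ι_smul]
        group }
  refine isIso_of_span (pair F I) m (pair_surjective _ _) ?_ ?_ ?_ ?_ ?_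
  · intro t ht
    obtain ⟨g, hg, hg'⟩ := (pair_eq_one t).1 ht
    show F.ι t.1.2.left * t.1.1 = 1
    rw [hg, hg']
    show F.ι (g⁻¹) * F.ι g = 1
    simp
  · intro x
    refine ⟨⟨(F.κ x, 1), by show F.γ (F.κ x) = I.δ 1; rw [F.γκ, map_one]⟩, rfl, ?_⟩
    show F.ι 1 * F.κ x = F.κ x
    simp
  · intro z
    refine ⟨⟨(1, I.ι z), by show F.γ 1 = I.δ (I.ι z); rw [I.δι, map_one]⟩, rfl, ?_⟩
    show F.ι z * 1 = F.ι z
    simp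
  · intro t
    show F.δ (F.ι t.1.2.left * t.1.1) = F.δ t.1.1
    rw [map_mul, F.δι, one_mul]
  · intro t
    show F.γ (F.ι t.1.2.left * t.1.1) = Y.bd t.1.2.left * t.1.2.right
    rw [map_mul, F.γι, key]

theorem comp_assoc_isIso (F : Butterfly X Y) (G : Butterfly Y Z) (H : Butterfly Z W) :
    IsIso (comp (comp F G) H) (comp F (comp G H)) := by
  let q : F.E × G.E × H.E →* Y.G₁ × Z.G₁ :=
    (F.γ.comp (MonoidHom.fst _ _)).prod
      (G.γ.comp ((MonoidHom.fst _ _).comp (MonoidHom.snd _ _)))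
  let r : F.E × G.E × H.E →* Y.G₁ × Z.G₁ :=
    (G.δ.comp ((MonoidHom.fst _ _).comp (MonoidHom.snd _ _))).prod
      (H.δ.comp ((MonoidHom.snd _ _).comp (MonoidHom.snd _ _)))
  let T : Subgroup (F.E × G.E × H.E) := q.eqLocus r
  have hT1 : ∀ t : T, F.γ t.1.1 = G.δ t.1.2.1 := fun t => congrArg Prod.fst t.2
  have hT2 : ∀ t : T, G.γ t.1.2.1 = H.δ t.1.2.2 := fun t => congrArg Prod.snd t.2
  let fg : T →* fibreProd F G :=
    { toFun := fun t => ⟨(t.1.1, t.1.2.1), hT1 t⟩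
      map_one' := rfl
      map_mul' := fun _ _ => rfl }
  let gh : T →* fibreProd G H :=
    { toFun := fun t => ⟨(t.1.2.1, t.1.2.2), hT2 t⟩
      map_one' := rfl
      map_mul' := fun _ _ => rfl }
  let a₀ : T →* fibreProd (comp F G) H :=
    { toFun := fun t => ⟨(pair F G (fg t), t.1.2.2), hT2 t⟩
      map_one' := Subtype.ext (Prod.ext (by simp) rfl)
      map_mul' := fun s t => Subtype.ext (Prod.ext (by simp) rfl) }
  let b₀ : T →* fibreProd F (comp G H) :=
    { toFun := fun t => ⟨(t.1.1, pair G H (gh t)), hT1 t⟩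
      map_one' := Subtype.ext (Prod.ext rfl (by simp))
      map_mul' := fun s t => Subtype.ext (Prod.ext rfl (by simp)) }
  refine isIso_of_span ((pair (comp F G) H).comp a₀) ((pair F (comp G H)).comp b₀)
    ?_ ?_ ?_ ?_ ?_ ?_
  · intro e
    obtain ⟨⟨⟨s, z⟩, hs⟩, rfl⟩ := pair_surjective _ _ e
    obtain ⟨⟨⟨x, y⟩, hx⟩, rfl⟩ := pair_surjective _ _ s
    exact ⟨⟨(x, y, z), Prod.ext hx hs⟩, rfl⟩
  · intro t ht
    obtain ⟨g, hg, hg'⟩ := (pair_eq_one (a₀ t)).1 ht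
    have hg0 : pair F G (fg t) = pair F G
      ⟨(1, G.ι g), by show F.γ 1 = G.δ (G.ι g); rw [G.δι, map_one]⟩ := hg
    rw [← mul_inv_eq_one, ← map_inv, ← map_mul, pair_eq_one] at hg0
    obtain ⟨y, h1, h2⟩ := hg0
    have h1' : t.1.1 * 1⁻¹ = F.ι y := h1
    have h2' : t.1.2.1 * (G.ι g)⁻¹ = G.κ y := h2
    have hg1 : t.1.2.2 = H.κ g := hg'
    refine (pair_eq_one (b₀ t)).2 ⟨y, ?_, ?_⟩
    · show t.1.1 = F.ι y
      rw [← h1']; simp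
    · show pair G H (gh t) = pair G H
        ⟨(G.κ y, 1), by show G.γ (G.κ y) = H.δ 1; rw [G.γκ, map_one]⟩
      rw [← inv_mul_eq_one, ← map_inv, ← map_mul, pair_eq_one]
      refine ⟨g⁻¹, ?_, ?_⟩
      · show t.1.2.1⁻¹ * G.κ y = _
        rw [← h2', map_inv]
        have h3 : t.1.2.1 * (G.ι g)⁻¹ = (G.ι g)⁻¹ * t.1.2.1 := by
          have h4 : t.1.2.1 = G.κ y * G.ι g := by rw [← h2']; group
          have h5 := G.ι_smul (G.κ y) g
          rw [G.γκ, one_smul] at h5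
          have h6 := eq_mul_inv_iff_mul_eq.1 h5
          rw [h2', h4, ← h6]
          group
        rw [h3, inv_mul_eq_iff_eq_mul, ← h3]
      · show t.1.2.2⁻¹ * 1 = _
        rw [hg1, map_inv]; group
  · intro x
    refine ⟨⟨(F.κ x, 1, 1), Prod.ext ?_ ?_⟩, rfl, ?_⟩
    · show F.γ (F.κ x) = G.δ 1
      rw [F.γκ, map_one]
    · show G.γ 1 = H.δ 1
      rw [map_one, map_one]
    · rfl
  · intro x
    refine ⟨⟨(1, 1, H.ι x), Prod.ext ?_ ?_⟩, rfl, rfl⟩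
    · show F.γ 1 = G.δ 1
      rw [map_one, map_one]
    · show G.γ 1 = H.δ (H.ι x)
      rw [H.δι, map_one]
  · intro t
    rfl
  · intro t
    rfl

/-! ### The morphism of modules induced by a butterfly -/

theorem exists_base (F : Butterfly X Y) (c : X.C) :
    ∃ c' : Y.C, ∀ e : F.E, X.p (F.δ e) = c → Y.p (F.γ e) = c' := by
  obtain ⟨g, hg⟩ := X.p_surjective c
  obtain ⟨e, rfl⟩ := F.δ_surjective g
  refine ⟨Y.p (F.γ e), fun e' he' => ?_⟩
  obtain ⟨x, hx⟩ := X.exists_bd (g := F.δ (e⁻¹ * e')) (by simp [hg, he'])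
  obtain ⟨y, hy⟩ := F.exists_ι (e := (F.κ x)⁻¹ * (e⁻¹ * e')) (by
    rw [map_mul, map_inv, F.δκ, hx]; group)
  have : e' = e * F.κ x * F.ι y := by rw [hy]; group
  rw [this]
  simp [F.γκ, F.γι, Y.p_bd]

theorem exists_fibre (F : Butterfly X Y) (b : X.B) :
    ∃ b' : Y.B, F.κ (X.j b) * F.ι (Y.j b') = 1 := by
  obtain ⟨y, hy⟩ := F.exists_ι (e := (F.κ (X.j b))⁻¹) (by
    rw [map_inv, F.δκ, X.bd_j, inv_one])
  obtain ⟨b', rfl⟩ := Y.exists_j (x := y) (by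
    rw [← F.γι, hy, map_inv, F.γκ, inv_one])
  exact ⟨b', by rw [hy]; group⟩

theorem fibre_unique (F : Butterfly X Y) {b : X.B} {b' b'' : Y.B}
    (h' : F.κ (X.j b) * F.ι (Y.j b') = 1) (h'' : F.κ (X.j b) * F.ι (Y.j b'') = 1) : b' = b'' :=
  Y.j_injective (F.ι_injective (mul_left_cancel (h'.trans h''.symm)))

theorem κι_comm (F : Butterfly X Y) (x : X.G₂) (y : Y.G₂) : F.κ x * F.ι y = F.ι y * F.κ x := by
  have := F.ι_smul (F.κ x) y
  rw [F.γκ, one_smul] at this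
  exact (eq_mul_inv_iff_mul_eq.1 this).symm

/-- The underlying map of `P₀(E) : X.C → Y.C`, sending `p (δ e)` to `p' (γ e)`. -/
noncomputable def base (F : Butterfly X Y) (c : X.C) : Y.C := (F.exists_base c).choose

theorem base_eq (F : Butterfly X Y) (e : F.E) : F.base (X.p (F.δ e)) = Y.p (F.γ e) :=
  ((F.exists_base _).choose_spec e rfl).symm

/-- The underlying map `φ : X.B → Y.B` of the map of modules induced by a butterfly: `(j, j' φ)`
is the kernel of `X.G₂ × Y.G₂ → E`, `(x, y) ↦ κ x * ι y`. -/
noncomputable def fibre (F : Butterfly X Y) (b : X.B) : Y.B := (F.exists_fibre b).choose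

theorem fibre_eq (F : Butterfly X Y) (b : X.B) : F.κ (X.j b) * F.ι (Y.j (F.fibre b)) = 1 :=
  (F.exists_fibre b).choose_spec

/-- The morphism `P(E) : Π(X) → Π(Y)` of group modules induced by a butterfly. -/
noncomputable def toModHom (F : Butterfly X Y) : X.toMod ⟶ Y.toMod where
  f₀ := MonoidHom.mk' (fun c : X.C => F.base c) (fun c d => by
    obtain ⟨g, rfl⟩ := X.p_surjective c
    obtain ⟨e, rfl⟩ := F.δ_surjective g
    obtain ⟨g', rfl⟩ := X.p_surjective d
    obtain ⟨e', rfl⟩ := F.δ_surjective g'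
    show F.base _ = F.base _ * F.base _
    rw [← map_mul, ← map_mul, base_eq, base_eq, base_eq, map_mul, map_mul])
  f := MonoidHom.mk' (fun b : X.B => F.fibre b) (fun b c => by
    refine F.fibre_unique (F.fibre_eq _) ?_
    rw [map_mul, map_mul, map_mul, map_mul]
    have h := F.fibre_eq b
    have h' := F.fibre_eq c
    rw [mul_assoc, ← mul_assoc (F.κ (X.j c)), F.κι_comm, mul_assoc, h', mul_one, h])
  equivariant c b := by
    obtain ⟨g, rfl⟩ := X.p_surjective c
    obtain ⟨e, rfl⟩ := F.δ_surjective g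
    show F.fibre (X.p (F.δ e) • (b : X.B)) = F.base (X.p (F.δ e)) • F.fibre b
    refine F.fibre_unique (F.fibre_eq _) ?_
    rw [base_eq, X.j_smul, Y.j_smul, F.κ_smul, F.ι_smul]
    have h := F.fibre_eq b
    calc _ = e * (F.κ (X.j b) * F.ι (Y.j (F.fibre b))) * e⁻¹ := by group
      _ = 1 := by rw [h]; group

theorem toModHom_eq {F G : Butterfly X Y} (h : IsIso F G) : F.toModHom = G.toModHom := by
  obtain ⟨α, h1, h2, h3, h4⟩ := h
  refine GrpMod.hom_ext (fun c => ?_) (fun b => ?_)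
  · obtain ⟨g, rfl⟩ := X.p_surjective c
    obtain ⟨e, rfl⟩ := F.δ_surjective g
    show F.base _ = G.base _
    rw [base_eq]
    rw [← h3, base_eq, h4]
  · show F.fibre _ = G.fibre _
    refine G.fibre_unique ?_ (G.fibre_eq _)
    rw [← h1, ← h2, ← map_mul, fibre_eq, map_one]

theorem toModHom_id (X : CrossedExt.{u}) : (ofHom (StrictHom.id X)).toModHom = 𝟙 X.toMod := by
  refine GrpMod.hom_ext (fun c => ?_) (fun b => ?_)
  · obtain ⟨g, rfl⟩ := X.p_surjective c
    have := (ofHom (StrictHom.id X)).base_eq (SemidirectProduct.inr g)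
    refine this.trans ?_
    show X.p (X.bd 1 * g) = X.p g
    simp
  · refine (ofHom (StrictHom.id X)).fibre_unique
      ((ofHom (StrictHom.id X)).fibre_eq _) ?_
    refine SemidirectProduct.ext ?_ ?_
    · show (X.j b)⁻¹ * (X.bd (X.j b) • X.j b) = 1
      rw [X.bd_j]; simp
    · show X.bd (X.j b) * 1 = 1
      rw [X.bd_j]; simp

theorem toModHom_comp (F : Butterfly X Y) (G : Butterfly Y Z) :
    (comp F G).toModHom = F.toModHom ≫ G.toModHom := by
  refine GrpMod.hom_ext (fun c => ?_) (fun b => ?_)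
  · obtain ⟨g, rfl⟩ := X.p_surjective c
    obtain ⟨e, rfl⟩ := F.δ_surjective g
    obtain ⟨e', he'⟩ := G.δ_surjective (F.γ e)
    refine ((comp F G).base_eq (pair F G ⟨(e, e'), he'.symm⟩)).trans ?_
    show Z.p (G.γ e') = G.base (F.base (X.p (F.δ e)))
    rw [base_eq, ← he', base_eq]
  · show (comp F G).fibre b = G.fibre (F.fibre b)
    refine (comp F G).fibre_unique ((comp F G).fibre_eq _) ?_
    refine (mk_eq_one (F := F) (F' := G) _).2 ⟨(Y.j (F.fibre b))⁻¹, ?_, ?_⟩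
    · show F.κ (X.j b) * 1 = F.ι _
      rw [map_inv, mul_one, eq_inv_iff_mul_eq_one, F.fibre_eq]
    · show 1 * G.ι (Z.j (G.fibre (F.fibre b))) = G.κ _
      rw [one_mul, map_inv]
      exact eq_inv_of_mul_eq_one_right (G.fibre_eq _)

end Butterfly

/-! ### The category `[BExt](Gp)` and the functor `P` -/

/-- The objects of `[BExt](Gp)` are the crossed extensions. -/
abbrev BExt := CrossedExt.{u}

/-- The category `[BExt](Gp)`: its morphisms are isomorphism classes of butterflies. -/
instance : Category BExt.{u} where
  Hom X Y := Quotient (Butterfly.setoid X Y)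
  id X := ⟦Butterfly.ofHom (StrictHom.id X)⟧
  comp F G := Quotient.map₂ Butterfly.comp
    (fun _ _ h _ _ h' => Butterfly.comp_isIso h h') F G
  id_comp F := by
    induction F using Quotient.inductionOn with
    | h F => exact Quotient.sound (Butterfly.id_comp_isIso F)
  comp_id F := by
    induction F using Quotient.inductionOn with
    | h F => exact Quotient.sound (Butterfly.comp_id_isIso F)
  assoc F G H := by
    induction F using Quotient.inductionOn with
    | h F =>
      induction G using Quotient.inductionOn with
      | h G =>
        induction H using Quotient.inductionOn with
        | h H => exact Quotient.sound (Butterfly.comp_assoc_isIso F G H)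

/-- The isomorphism class of a butterfly, as a morphism of `[BExt](Gp)`. -/
def BExt.cls {X Y : BExt.{u}} (F : Butterfly X Y) :
    X ⟶ Y := Quotient.mk _ F

/-- The value `Q(f) = [𝓑(f)]` in `[BExt](Gp)` of a morphism `f` of crossed extensions. -/
def BExt.ofHom {X Y : BExt.{u}} (f : StrictHom X Y) :
    X ⟶ Y := BExt.cls (Butterfly.ofHom f)

/-- The functor `P : [BExt](Gp) → Mod(Gp)`, with `P(X) = Π(X)`. -/
noncomputable def P : BExt.{u} ⥤ GrpMod.{u} where
  obj X := CrossedExt.toMod X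
  map F := Quotient.lift Butterfly.toModHom (fun _ _ h => Butterfly.toModHom_eq h) F
  map_id X := Butterfly.toModHom_id X
  map_comp F G := by
    induction F using Quotient.inductionOn with
    | h F =>
      induction G using Quotient.inductionOn with
      | h G => exact Butterfly.toModHom_comp F G

/-! ### Pullback and push forward of crossed extensions -/

namespace CrossedExt

/-- The group `X.G₁ ×_{X.C} C`. -/
def pullbackG₁ (X : CrossedExt.{u}) {C : Type u} [Group C] (φ : C →* X.C) :
    Subgroup (X.G₁ × C) :=
  (X.p.comp (MonoidHom.fst X.G₁ C)).eqLocus (φ.comp (MonoidHom.snd X.G₁ C))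

instance (X : CrossedExt.{u}) {C : Type u} [Group C] (φ : C →* X.C) :
    MulDistribMulAction (X.pullbackG₁ φ) X.G₂ :=
  MulDistribMulAction.compHom X.G₂
    ((MonoidHom.fst X.G₁ C).comp (X.pullbackG₁ φ).subtype)

theorem pullback_smul (X : CrossedExt.{u}) {C : Type u} [Group C] (φ : C →* X.C)
    (g : X.pullbackG₁ φ) (x : X.G₂) : g • x = g.1.1 • x := rfl

/-- The pullback `φ^* X` of a crossed extension along a group homomorphism `φ : C → X.C`:
`1 → X.B → X.G₂ → X.G₁ ×_{X.C} C → C → 1`. -/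
def pullback (X : CrossedExt.{u}) {C : Type u} [Group C] (φ : C →* X.C) : CrossedExt.{u} where
  B := X.B
  G₂ := X.G₂
  G₁ := X.pullbackG₁ φ
  C := C
  j := X.j
  bd := (X.bd.prod (1 : X.G₂ →* C)).codRestrict (X.pullbackG₁ φ) fun x =>
    show X.p (X.bd x) = φ 1 by rw [X.p_bd, map_one]
  p := (MonoidHom.snd X.G₁ C).comp (X.pullbackG₁ φ).subtype
  bd_smul g x := by
    apply Subtype.ext
    apply Prod.ext
    · exact X.bd_smul g.1.1 x
    · show (1 : C) = g.1.2 * 1 * g.1.2⁻¹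
      group
  peiffer x y := X.peiffer x y
  j_injective := X.j_injective
  exact₂ := by
    ext x
    constructor
    · rintro ⟨b, rfl⟩
      exact Subtype.ext (Prod.ext (X.bd_j b) rfl)
    · intro h
      exact X.exists_j (congrArg (fun t => t.1.1) (show _ = _ from h))
  exact₁ := by
    ext g
    constructor
    · rintro ⟨x, rfl⟩
      rfl
    · intro h
      have h' : g.1.2 = 1 := h
      have hg : X.p g.1.1 = φ g.1.2 := g.2
      obtain ⟨x, hx⟩ := X.exists_bd (g := g.1.1) (by rw [hg, h', map_one])
      exact ⟨x, Subtype.ext (Prod.ext hx h'.symm)⟩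
  p_surjective c := by
    obtain ⟨g, hg⟩ := X.p_surjective (φ c)
    exact ⟨⟨(g, c), hg⟩, rfl⟩

/-- The canonical (cartesian) morphism `φ^* X → X`. -/
def pullbackHom (X : CrossedExt.{u}) {C : Type u} [Group C] (φ : C →* X.C) :
    StrictHom (X.pullback φ) X where
  f₁ := (MonoidHom.fst X.G₁ C).comp (X.pullbackG₁ φ).subtype
  f₂ := MonoidHom.id X.G₂
  comm _ := rfl
  equivariant _ _ := rfl

theorem toMod_pullback (X : CrossedExt.{u}) {C : Type u} [Group C] (φ : C →* X.C) :
    (X.pullback φ).toMod = X.toMod.res φ := by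
  refine GrpMod.mk_congr _ _ fun c b => X.j_injective ?_
  obtain ⟨g, hg⟩ := X.p_surjective (φ c)
  have h1 := (X.pullback φ).j_smul ⟨(g, c), hg⟩ b
  have h2 := X.j_smul g b
  rw [hg] at h2
  exact h1.trans h2.symm

section pushforward

variable (X : CrossedExt.{u}) {B' : Type u} [CommGroup B'] (β : X.B →* B')

/-- The homomorphism `b ↦ (β b, (j b)⁻¹)`. -/
def pushIncl : X.B →* B' × X.G₂ where
  toFun b := (β b, (X.j b)⁻¹)
  map_one' := by simp
  map_mul' a b := by
    ext
    · simp
    · show (X.j (a * b))⁻¹ = (X.j a)⁻¹ * (X.j b)⁻¹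
      rw [map_mul, mul_inv_rev, ← map_inv, X.j_comm]

instance : (X.pushIncl β).range.Normal where
  conj_mem := by
    rintro _ ⟨b, rfl⟩ ⟨c, x⟩
    refine ⟨b, Prod.ext ?_ ?_⟩
    · show β b = c * β b * c⁻¹
      rw [mul_comm c]; group
    · show (X.j b)⁻¹ = x * (X.j b)⁻¹ * x⁻¹
      rw [← map_inv, ← X.j_comm]; group

/-- The group `B' ×^B X.G₂`. -/
abbrev PushG₂ := (B' × X.G₂) ⧸ (X.pushIncl β).range

variable [MulDistribMulAction X.C B'] (hβ : ∀ (c : X.C) (b : X.B), β (c • b) = c • β b)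

/-- The action of `X.G₁` on `B' ×^B X.G₂`, given by `g • [b', x] = [p g • b', g • x]`. -/
abbrev pushAct : MulDistribMulAction X.G₁ (X.PushG₂ β) where
  smul g := QuotientGroup.map (X.pushIncl β).range (X.pushIncl β).range
    ((MulDistribMulAction.toMonoidHom B' (X.p g)).prodMap
      (MulDistribMulAction.toMonoidHom X.G₂ g)) (by
        rintro _ ⟨b, rfl⟩
        refine ⟨X.p g • b, Prod.ext ?_ ?_⟩
        · exact hβ _ _
        · show (X.j (X.p g • b))⁻¹ = g • (X.j b)⁻¹
          rw [X.j_smul, smul_inv'])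
  one_smul q := by
    induction q using QuotientGroup.induction_on with
    | H t =>
      refine congrArg (QuotientGroup.mk' _) (Prod.ext ?_ ?_)
      · show X.p 1 • t.1 = t.1
        simp
      · show (1 : X.G₁) • t.2 = t.2
        simp
  mul_smul g h q := by
    induction q using QuotientGroup.induction_on with
    | H t =>
      refine congrArg (QuotientGroup.mk' _) (Prod.ext ?_ ?_)
      · show X.p (g * h) • t.1 = X.p g • X.p h • t.1
        simp [mul_smul]
      · show (g * h) • t.2 = g • h • t.2
        simp [mul_smul]
  smul_one g := map_one (QuotientGroup.map _ _ _ _)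
  smul_mul g a b := map_mul (QuotientGroup.map _ _ _ _) a b

/-- The push forward `β_* X` of a crossed extension along a morphism `β : X.B → B'` of
`X.C`-modules: `1 → B' → B' ×^B X.G₂ → X.G₁ → X.C → 1`. -/
def pushforward : CrossedExt.{u} :=
  letI := X.pushAct β hβ
  { B := B'
    G₂ := X.PushG₂ β
    G₁ := X.G₁
    C := X.C
    j := (QuotientGroup.mk' _).comp (MonoidHom.inl B' X.G₂)
    bd := QuotientGroup.lift _ (X.bd.comp (MonoidHom.snd B' X.G₂)) (by
      rintro _ ⟨b, rfl⟩
      show X.bd (X.j b)⁻¹ = 1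
      rw [map_inv, X.bd_j, inv_one])
    p := X.p
    bd_smul := fun g q => by
      induction q using QuotientGroup.induction_on with
      | H t => exact X.bd_smul g t.2
    peiffer := fun q r => by
      induction q using QuotientGroup.induction_on with
      | H t =>
        induction r using QuotientGroup.induction_on with
        | H s =>
          refine congrArg (QuotientGroup.mk' _) (Prod.ext ?_ ?_)
          · show X.p (X.bd t.2) • s.1 = t.1 * s.1 * t.1⁻¹
            rw [X.p_bd, one_smul, mul_comm t.1]; group
          · exact X.peiffer t.2 s.2
    j_injective := by
      rw [injective_iff_map_eq_one]
      intro b' hb'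
      obtain ⟨b, hb⟩ := (QuotientGroup.eq_one_iff _).1 hb'
      have h1 : β b = b' := congrArg Prod.fst hb
      have h2 : (X.j b)⁻¹ = 1 := congrArg Prod.snd hb
      have h3 : b = 1 := X.j_injective (by rw [map_one, ← inv_eq_one, h2])
      rw [← h1, h3, map_one]
    exact₂ := by
      ext q
      constructor
      · rintro ⟨b', rfl⟩
        exact map_one X.bd
      · obtain ⟨⟨b', x⟩, rfl⟩ := QuotientGroup.mk'_surjective _ q
        intro h
        obtain ⟨b, rfl⟩ := X.exists_j (x := x) h
        refine ⟨b' * β b, (QuotientGroup.mk'_eq_mk' _).2 ⟨_, ⟨b⁻¹, rfl⟩, Prod.ext ?_ ?_⟩⟩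
        · show b' * β b * β b⁻¹ = b'
          simp
        · show 1 * (X.j b⁻¹)⁻¹ = X.j b
          simp
    exact₁ := by
      ext g
      constructor
      · rintro ⟨q, rfl⟩
        obtain ⟨t, rfl⟩ := QuotientGroup.mk'_surjective _ q
        exact X.p_bd t.2
      · intro h
        obtain ⟨x, rfl⟩ := X.exists_bd h
        exact ⟨QuotientGroup.mk' _ (1, x), rfl⟩
    p_surjective := X.p_surjective }

/-- The canonical (opcartesian) morphism `X → β_* X`. -/
def pushforwardHom : StrictHom X (X.pushforward β hβ) where
  f₁ := MonoidHom.id X.G₁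
  f₂ := (QuotientGroup.mk' _).comp (MonoidHom.inr B' X.G₂)
  comm _ := rfl
  equivariant g x := by
    refine congrArg (QuotientGroup.mk' _) (Prod.ext ?_ rfl)
    show 1 = X.p g • (1 : B')
    simp

theorem toMod_pushforward : (X.pushforward β hβ).toMod = GrpMod.mk X.C B' := by
  refine GrpMod.mk_congr _ _ fun c b => (X.pushforward β hβ).j_injective ?_
  obtain ⟨g, rfl⟩ := X.p_surjective c
  refine ((X.pushforward β hβ).j_smul g b).trans ?_
  refine congrArg (QuotientGroup.mk' _) (Prod.ext rfl ?_)
  show g • (1 : X.G₂) = 1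
  simp

end pushforward

end CrossedExt

/-! ### The objects `φ^* X'` and `φ_* X` attached to a morphism of modules -/

section obstruction

variable {X X' : BExt.{u}} (φ : X.toMod ⟶ X'.toMod)

/-- `φ^* X'` for `φ = (φ₀, φ) : Π(X) → Π(X')`: the pullback of `X'` along `φ₀`. -/
noncomputable def upperStar : BExt.{u} := CrossedExt.pullback (C := X.C) X' φ.f₀

/-- `φ_* X` for `φ = (φ₀, φ) : Π(X) → Π(X')`: the push forward of `X` along `φ`, seen as a
morphism of `X.C`-modules from `X.B` to the restriction of `X'.B` along `φ₀`. -/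
noncomputable def lowerStar : BExt.{u} :=
  letI : MulDistribMulAction (X.C) (X'.B) := (X'.toMod.res φ.f₀).act
  CrossedExt.pushforward (B' := X'.B) X φ.f φ.equivariant

/-- The morphism `φ^* X' → X'` of `[BExt](Gp)`. -/
noncomputable def fromUpperStar : upperStar φ ⟶ X' :=
  BExt.ofHom (CrossedExt.pullbackHom (C := X.C) X' φ.f₀)

/-- The morphism `X → φ_* X` of `[BExt](Gp)`. -/
noncomputable def toLowerStar : X ⟶ lowerStar φ :=
  letI : MulDistribMulAction (X.C) (X'.B) := (X'.toMod.res φ.f₀).act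
  BExt.ofHom (CrossedExt.pushforwardHom (B' := X'.B) X φ.f φ.equivariant)

theorem P_lowerStar : P.obj (lowerStar φ) = P.obj (upperStar φ) :=
  letI : MulDistribMulAction (X.C) (X'.B) := (X'.toMod.res φ.f₀).act
  (CrossedExt.toMod_pushforward (B' := X'.B) X φ.f φ.equivariant).trans
    (CrossedExt.toMod_pullback (C := X.C) X' φ.f₀).symm

/-- The fibre of `P` over `Π(φ^* X')`. -/
abbrev PFibre := P.Fiber (P.obj (upperStar φ))

/-- `φ^* X'` as an object of the fibre of `P` over `Π(φ^* X')`. -/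
noncomputable def upperStarFib : PFibre φ := Functor.Fiber.mk (a := upperStar φ) rfl

/-- `φ_* X` as an object of the fibre of `P` over `Π(φ^* X')`. -/
noncomputable def lowerStarFib : PFibre φ := Functor.Fiber.mk (P_lowerStar φ)

end obstruction

end XExt

/-! A butterfly `X → X'` over `φ` and a butterfly `φ_* X → φ^* X'` in the fibre are the same data on
one and the same group `E`. Given `F` over `φ`, the maps `γ : E → G₁'` and `p δ : E → C` agree over
`C'`, which is the condition on `φ₀`, so together they land in `G₁' ×_{C'} C`. Dually, `κ` on `G₂`
and `b' ↦ ι (j' b')⁻¹` on `B'` agree along `B`, which is the condition on `φ`, so together they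
factor through `B' ×^B G₂`. These are the constructions `outer` and `inner`. Since `cls_outer`
identifies `outer` with `w ∘ G ∘ u`, the map `g ↦ w ∘ g ∘ u` is a bijection from morphisms of the
fibre to morphisms over `φ` (`fibreHomEquiv`).

Moreover every morphism `φ_* X → φ^* X'` of the fibre is invertible (`isIso_fibreHom`): a butterfly
inducing bijections on `C` and `B` has both diagonals short exact, and reading it backwards gives
its inverse. Hence morphisms over `φ` exist exactly when the two objects are isomorphic in the
fibre, and a nonempty set of isomorphisms is a torsor under the automorphisms of the target. The
bijection carries this torsor to the morphisms over `φ`. -/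

namespace XExt

/-! ### Composition with the butterfly of a strict morphism. -/

namespace Butterfly

variable {X Y Z : CrossedExt.{u}}

/-- If a butterfly `H` maps to a butterfly `F` over a strict morphism `f` of the domains, then `H`
is isomorphic to the composite of the butterfly of `f` with `F`. -/
theorem isIso_ofHom_comp (f : StrictHom X Y) (F : Butterfly Y Z) (H : Butterfly X Z)
    (θ : H.E →* F.E) (hκ : ∀ x, θ (H.κ x) = F.κ (f.f₂ x)) (hι : ∀ z, θ (H.ι z) = F.ι z)
    (hδ : ∀ e, F.δ (θ e) = f.f₁ (H.δ e)) (hγ : ∀ e, F.γ (θ e) = H.γ e) :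
    IsIso H (comp (ofHom f) F) := by
  let m : H.E →* fibreProd (ofHom f) F :=
    ((SemidirectProduct.inr.comp H.δ).prod θ).codRestrict _ fun e => by
      show Y.bd 1 * f.f₁ (H.δ e) = F.δ (θ e)
      rw [hδ, map_one, one_mul]
  refine isIso_of_span (MonoidHom.id _) ((pair _ _).comp m) Function.surjective_id ?_ ?_ ?_ ?_ ?_
  · rintro e rfl
    exact map_one _
  · intro x
    -- The two representatives `((1, ∂x), θ (κ x))` and `(κ x, 1)` differ by the image of `f₂ x`
    -- under `fibreProdIncl`; the Peiffer identity gives the first coordinate.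
    refine ⟨H.κ x, rfl, (QuotientGroup.mk'_eq_mk' _).2
      ⟨(fibreProdIncl (ofHom f) F (f.f₂ x))⁻¹, inv_mem ⟨_, rfl⟩, ?_⟩⟩
    rw [mul_inv_eq_iff_eq_mul]
    refine Subtype.ext (Prod.ext (SemidirectProduct.ext ?_ ?_) ?_)
    · show 1 = (f.f₂ x)⁻¹ * (f.f₁ (X.bd x) • f.f₂ x)
      rw [← f.comm, Y.peiffer]
      group
    · show H.δ (H.κ x) = X.bd x * 1
      rw [H.δκ, mul_one]
    · show θ (H.κ x) = 1 * F.κ (f.f₂ x)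
      rw [hκ, one_mul]
  · intro z
    refine ⟨H.ι z, rfl, congrArg (pair _ _) (Subtype.ext (Prod.ext ?_ (hι z)))⟩
    show SemidirectProduct.inr (H.δ (H.ι z)) = 1
    rw [H.δι, map_one]
  · intro e
    rfl
  · exact hγ

/-- If a butterfly `F` maps to a butterfly `H` over a strict morphism `f` of the codomains, then
the composite of `F` with the butterfly of `f` is isomorphic to `H`. -/
theorem comp_ofHom_isIso (F : Butterfly X Y) (f : StrictHom Y Z) (H : Butterfly X Z)
    (θ : F.E →* H.E) (hκ : ∀ x, θ (F.κ x) = H.κ x) (hι : ∀ y, θ (F.ι y) = H.ι (f.f₂ y))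
    (hδ : ∀ e, H.δ (θ e) = F.δ e) (hγ : ∀ e, H.γ (θ e) = f.f₁ (F.γ e)) :
    IsIso (comp F (ofHom f)) H := by
  have key : ∀ t : fibreProd F (ofHom f), F.γ t.1.1 = t.1.2.right := fun t => t.2
  -- An element is `(e, (z, γ e))`. Multiplicativity of `ι z * θ e` is `ι_smul` for `H`, because `f₁
  -- (γ e)` is `γ (θ e)`.
  let m : fibreProd F (ofHom f) →* H.E :=
    { toFun := fun t => H.ι t.1.2.left * θ t.1.1
      map_one' := by
        show H.ι 1 * θ 1 = 1
        simp
      map_mul' := fun s t => by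
        show H.ι (s.1.2.left * (f.f₁ s.1.2.right • t.1.2.left)) * θ (s.1.1 * t.1.1) =
          H.ι s.1.2.left * θ s.1.1 * (H.ι t.1.2.left * θ t.1.1)
        rw [← key, ← hγ, map_mul, map_mul, H.ι_smul]
        group }
  refine isIso_of_span (pair _ _) m (pair_surjective _ _) ?_ ?_ ?_ ?_ ?_
  · intro t ht
    obtain ⟨g, hg, hg'⟩ := (pair_eq_one t).1 ht
    show H.ι t.1.2.left * θ t.1.1 = 1
    rw [hg, hg', hι, ← map_mul]
    show H.ι ((f.f₂ g)⁻¹ * f.f₂ g) = 1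
    rw [inv_mul_cancel, map_one]
  · intro x
    refine ⟨⟨(F.κ x, 1), by show F.γ (F.κ x) = (ofHom f).δ 1; rw [F.γκ, map_one]⟩, rfl, ?_⟩
    show H.ι 1 * θ (F.κ x) = H.κ x
    rw [hκ, map_one, one_mul]
  · intro z
    refine ⟨⟨(1, (ofHom f).ι z), by
      show F.γ 1 = (ofHom f).δ ((ofHom f).ι z); rw [(ofHom f).δι, map_one]⟩, rfl, ?_⟩
    show H.ι z * θ 1 = H.ι z
    rw [map_one, mul_one]
  · intro t
    show H.δ (H.ι t.1.2.left * θ t.1.1) = F.δ t.1.1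
    rw [map_mul, H.δι, one_mul, hδ]
  · intro t
    show H.γ (H.ι t.1.2.left * θ t.1.1) = Z.bd t.1.2.left * f.f₁ t.1.2.right
    rw [map_mul, H.γι, hγ, key]

/-! ### Butterflies inducing isomorphisms of modules are invertible -/

/-- A butterfly is flippable if `(γ, κ)` is a short exact sequence as well. -/
structure Flippable (F : Butterfly X Y) : Prop where
  κ_injective : Function.Injective F.κ
  γ_surjective : Function.Surjective F.γ
  exact : F.κ.range = F.γ.ker

/-- A diagram chase. The kernel of `κ` lies in `j B`, where `κ` is governed by `fibre`; the image of
`γ` contains `∂' G₂'` and covers `C'` through `base`. Exactness in the middle uses injectivity of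
`base` and surjectivity of `fibre`. -/
theorem flippable_of_bijective (F : Butterfly X Y) (h₀ : Function.Bijective F.base)
    (h : Function.Bijective F.fibre) : F.Flippable where
  κ_injective := by
    rw [injective_iff_map_eq_one]
    intro x hx
    obtain ⟨b, rfl⟩ := X.exists_j (x := x) (by rw [← F.δκ, hx, map_one])
    have hb : b = 1 := h.1 (F.fibre_unique (b := b) (F.fibre_eq b) (by
      have h1 := F.fibre_eq 1
      rw [map_one, map_one, one_mul] at h1
      rw [hx, one_mul, h1]))
    rw [hb, map_one]
  γ_surjective g := by
    obtain ⟨c, hc⟩ := h₀.2 (Y.p g)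
    obtain ⟨g', rfl⟩ := X.p_surjective c
    obtain ⟨e, rfl⟩ := F.δ_surjective g'
    rw [F.base_eq] at hc
    obtain ⟨y, hy⟩ := Y.exists_bd (g := (F.γ e)⁻¹ * g) (by rw [map_mul, map_inv, hc]; group)
    exact ⟨e * F.ι y, by rw [map_mul, F.γι, hy]; group⟩
  exact := by
    ext e
    constructor
    · rintro ⟨x, rfl⟩
      exact F.γκ x
    · intro he
      have he : F.γ e = 1 := he
      have hp : X.p (F.δ e) = 1 := h₀.1 (by
        have h1 := F.base_eq 1
        rw [map_one, map_one, map_one, map_one] at h1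
        rw [F.base_eq, he, map_one, h1])
      obtain ⟨x, hx⟩ := X.exists_bd hp
      obtain ⟨y, hy⟩ := F.exists_ι (e := (F.κ x)⁻¹ * e) (by
        rw [map_mul, map_inv, F.δκ, hx, inv_mul_cancel])
      obtain ⟨b', rfl⟩ := Y.exists_j (x := y) (by
        rw [← F.γι, hy, map_mul, map_inv, F.γκ, he, inv_one, one_mul])
      obtain ⟨b, rfl⟩ := h.2 b'
      -- Here `e = κ x * ι (j' b')` with `b'` the image of `b`, and `ι (j' b')` is the inverse of `κ
      -- (j b)`.
      refine ⟨x * (X.j b)⁻¹, ?_⟩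
      have hb := F.fibre_eq b
      rw [hy] at hb
      rw [map_mul, map_inv, inv_eq_of_mul_eq_one_right hb, mul_inv_cancel_left]

/-- The butterfly with the two short exact sequences interchanged. -/
def flip (F : Butterfly X Y) (hF : F.Flippable) : Butterfly Y X where
  E := F.E
  κ := F.ι
  ι := F.κ
  δ := F.γ
  γ := F.δ
  δκ := F.γι
  γι := F.δκ
  γκ := F.δι
  ι_injective := hF.κ_injective
  δ_surjective := hF.γ_surjective
  exact := hF.exact
  κ_smul := F.ι_smul
  ι_smul := F.κ_smul

theorem Flippable.flip {F : Butterfly X Y} (hF : F.Flippable) : (F.flip hF).Flippable :=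
  ⟨F.ι_injective, F.δ_surjective, F.exact⟩

/-- Two elements of `E` with equal `γ` have the form `e` and `κ x * e`, so the fibre product is `G₂
⋊ E`. The subgroup divided out is the diagonal copy of `ι G₂' = ker δ`, sitting in the factor `E`,
and the quotient is `G₂ ⋊ G₁`, the group of the identity butterfly. -/
theorem isIso_comp_flip (F : Butterfly X Y) (hF : F.Flippable) :
    IsIso (ofHom (StrictHom.id X)) (comp F (F.flip hF)) := by
  let ψ : F.E →* MulAut X.G₂ := (MulDistribMulAction.toMulAut X.G₁ X.G₂).comp F.δ
  let a : X.G₂ ⋊[ψ] F.E →* (ofHom (StrictHom.id X)).E :=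
    { toFun := fun t => ⟨t.left, F.δ t.right⟩
      map_one' := SemidirectProduct.ext rfl (map_one _)
      map_mul' := fun s t => SemidirectProduct.ext rfl (map_mul _ _ _) }
  let b : X.G₂ ⋊[ψ] F.E →* fibreProd F (F.flip hF) :=
    { toFun := fun t => ⟨(t.right, F.κ t.left * t.right), by
        show F.γ t.right = F.γ (F.κ t.left * t.right)
        rw [map_mul, F.γκ, one_mul]⟩
      map_one' := Subtype.ext (Prod.ext rfl (by
        show F.κ 1 * 1 = 1
        rw [map_one, one_mul]))
      map_mul' := fun s t => Subtype.ext (Prod.ext rfl (by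
        show F.κ (s.left * (F.δ s.right • t.left)) * (s.right * t.right) =
          F.κ s.left * s.right * (F.κ t.left * t.right)
        rw [map_mul, F.κ_smul]
        group)) }
  refine isIso_of_span a ((pair _ _).comp b) ?_ ?_ ?_ ?_ ?_ ?_
  · rintro ⟨x, g⟩
    obtain ⟨e, rfl⟩ := F.δ_surjective g
    exact ⟨⟨x, e⟩, rfl⟩
  · rintro ⟨x, e⟩ h
    have hx : x = 1 := congrArg SemidirectProduct.left h
    have he : F.δ e = 1 := congrArg SemidirectProduct.right h
    obtain ⟨y, rfl⟩ := F.exists_ι he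
    subst hx
    refine (pair_eq_one (b _)).2 ⟨y, rfl, ?_⟩
    show F.κ 1 * F.ι y = F.ι y
    rw [map_one, one_mul]
  · intro x
    -- This element lies over `(x⁻¹, ∂x)` on one side and over `(κ x, 1)` on the other.
    refine ⟨⟨x⁻¹, F.κ x⟩, SemidirectProduct.ext rfl (F.δκ x),
      congrArg (pair _ _) (Subtype.ext (Prod.ext rfl ?_))⟩
    show F.κ x⁻¹ * F.κ x = 1
    rw [← map_mul, inv_mul_cancel, map_one]
  · intro y
    refine ⟨⟨y, 1⟩, SemidirectProduct.ext rfl (map_one _),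
      congrArg (pair _ _) (Subtype.ext (Prod.ext rfl ?_))⟩
    exact mul_one (F.κ y)
  · intro t
    rfl
  · intro t
    show F.δ (F.κ t.left * t.right) = X.bd t.left * F.δ t.right
    rw [map_mul, F.δκ]

end Butterfly

/-- The class of a flippable butterfly is an isomorphism. -/
theorem BExt.isIso_cls {X Y : BExt.{u}} (F : Butterfly X Y) (hF : F.Flippable) :
    IsIso (BExt.cls F) :=
  ⟨BExt.cls (F.flip hF),
    Quotient.sound ((Butterfly.setoid _ _).symm (F.isIso_comp_flip hF)),
    -- Flipping twice gives back `F` definitionally, so the second identity is the first one for the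
    -- flipped butterfly.
    Quotient.sound ((Butterfly.setoid _ _).symm ((F.flip hF).isIso_comp_flip hF.flip))⟩

/-! ### Morphisms over a prescribed morphism of modules -/

/-- `Π(φ_* X)` and `Π(φ^* X')` have the same underlying groups and only their action terms differ,
so the transport between them is invisible on elements. -/
theorem GrpMod.eqToHom_f₀ {C B : Type u} [Group C] [CommGroup B]
    {a a' : MulDistribMulAction C B} (h : GrpMod.mk C B (act := a) = GrpMod.mk C B (act := a'))
    (c : C) : (eqToHom h).f₀ c = c := by
  obtain rfl : a = a' := by simpa using h
  rfl

theorem GrpMod.eqToHom_f {C B : Type u} [Group C] [CommGroup B]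
    {a a' : MulDistribMulAction C B} (h : GrpMod.mk C B (act := a) = GrpMod.mk C B (act := a'))
    (b : B) : (eqToHom h).f b = b := by
  obtain rfl : a = a' := by simpa using h
  rfl

variable {X X' : BExt.{u}}

/-- Replaces the chosen values `base` and `fibre` by equations in `E`. They determine `φ` since `p
δ` is surjective and `ι j'` is injective. -/
theorem Butterfly.P_map_cls_eq_iff (F : Butterfly X X') (φ : X.toMod ⟶ X'.toMod) :
    P.map (BExt.cls F) = φ ↔ (∀ e, φ.f₀ (X.p (F.δ e)) = X'.p (F.γ e)) ∧
      ∀ b : X.B, F.κ (X.j b) * F.ι (X'.j (φ.f b)) = 1 := by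
  constructor
  · rintro rfl
    exact ⟨F.base_eq, F.fibre_eq⟩
  · rintro ⟨h₀, h⟩
    refine GrpMod.hom_ext (fun c => ?_) (fun b => F.fibre_unique (F.fibre_eq b) (h b))
    obtain ⟨g, rfl⟩ := X.p_surjective c
    obtain ⟨e, rfl⟩ := F.δ_surjective g
    exact (F.base_eq e).trans (h₀ e).symm

/-! ### The fibre condition on butterflies `φ_* X → φ^* X'`. -/

section fibre

variable {X X' : BExt.{u}} (φ : X.toMod ⟶ X'.toMod)

/-- Lying over the identity means being sent by `P` to the `eqToHom` of `P_lowerStar`, which is the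
identity on elements of `C` and `B'`. -/
theorem isHomLift_cls_iff (G : Butterfly (lowerStar φ) (upperStar φ)) :
    P.IsHomLift (𝟙 (P.obj (upperStar φ))) (BExt.cls G) ↔
      (∀ e, (lowerStar φ).p (G.δ e) = (upperStar φ).p (G.γ e)) ∧
        ∀ b' : X'.B, G.κ ((lowerStar φ).j b') * G.ι ((upperStar φ).j b') = 1 := by
  have h₁ : P.IsHomLift (𝟙 (P.obj (upperStar φ))) (BExt.cls G) ↔
      P.map (BExt.cls G) = eqToHom (P_lowerStar φ) := by
    constructor
    · intro h
      have h' := IsHomLift.fac' P (𝟙 (P.obj (upperStar φ))) (BExt.cls G)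
      rwa [Category.id_comp, eqToHom_refl, Category.comp_id] at h'
    · intro h
      refine IsHomLift.of_fac' P _ _ (P_lowerStar φ) rfl ?_
      rw [h, Category.id_comp, eqToHom_refl, Category.comp_id]
  refine h₁.trans ((G.P_map_cls_eq_iff _).trans ?_)
  have h₀ (c : X.C) : (eqToHom (P_lowerStar φ)).f₀ c = c := GrpMod.eqToHom_f₀ _ c
  have h (b : X'.B) : (eqToHom (P_lowerStar φ)).f b = b := GrpMod.eqToHom_f _ b
  exact and_congr (forall_congr' fun e => Eq.congr_left (h₀ _))
    (forall_congr' fun b => Eq.congr_left (congrArg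
      (fun t : X'.B => G.κ ((lowerStar φ).j b) * G.ι ((upperStar φ).j t)) (h b)))

/-- The canonical map `X'.B × X.G₂ → (φ_* X).G₂`. -/
noncomputable def lowerStarMk : X'.B × X.G₂ →* (lowerStar φ).G₂ := QuotientGroup.mk' _

theorem lowerStarMk_surjective : Function.Surjective (lowerStarMk φ) :=
  QuotientGroup.mk'_surjective _

theorem smul_lowerStarMk (g : X.G₁) (b' : X'.B) (x : X.G₂) :
    (show (lowerStar φ).G₁ from g) • lowerStarMk φ (b', x) =
      lowerStarMk φ (φ.f₀ (X.p g) • b', g • x) := rfl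

/-! ### Passing between butterflies over `φ` and butterflies in the fibre. -/

namespace Butterfly

/-- The composite of a butterfly `φ_* X → φ^* X'` with the canonical morphisms, realised on the
same group. -/
noncomputable def outer (G : Butterfly (lowerStar φ) (upperStar φ)) : Butterfly X X' where
  E := G.E
  κ := (G.κ.comp (lowerStarMk φ)).comp (MonoidHom.inr X'.B X.G₂)
  ι := G.ι
  δ := G.δ
  γ := (CrossedExt.pullbackHom (C := X.C) X' φ.f₀).f₁.comp G.γ
  δκ h := G.δκ _
  γι g := congrArg (CrossedExt.pullbackHom (C := X.C) X' φ.f₀).f₁ (G.γι g)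
  γκ h := congrArg (CrossedExt.pullbackHom (C := X.C) X' φ.f₀).f₁ (G.γκ _)
  ι_injective := G.ι_injective
  δ_surjective := G.δ_surjective
  exact := G.exact
  κ_smul e h := by
    refine Eq.trans ?_ (G.κ_smul e (lowerStarMk φ (1, h)))
    refine congrArg G.κ (Eq.trans ?_ (smul_lowerStarMk φ (G.δ e) 1 h).symm)
    rw [smul_one]
    rfl
  ι_smul e g := G.ι_smul e g

theorem cls_outer (G : Butterfly (lowerStar φ) (upperStar φ)) :
    BExt.cls (G.outer φ) = toLowerStar φ ≫ BExt.cls G ≫ fromUpperStar φ := by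
  let _ : MulDistribMulAction (X.C) (X'.B) := (X'.toMod.res φ.f₀).act
  -- The intermediate composite `φ_* X → X'` also lives on `G.E`, so both comparisons use the
  -- identity of that group as `θ`.
  let M : Butterfly (lowerStar φ) X' :=
    { G with
      γ := (CrossedExt.pullbackHom (C := X.C) X' φ.f₀).f₁.comp G.γ
      γι := (G.outer φ).γι
      γκ := fun h => congrArg (CrossedExt.pullbackHom (C := X.C) X' φ.f₀).f₁ (G.γκ h)
      ι_smul := (G.outer φ).ι_smul }
  have h₁ : BExt.cls G ≫ fromUpperStar φ = BExt.cls M :=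
    Quotient.sound (comp_ofHom_isIso G _ M (MonoidHom.id _) (fun _ => rfl) (fun _ => rfl)
      (fun _ => rfl) (fun _ => rfl))
  have h₂ : BExt.cls (G.outer φ) = toLowerStar φ ≫ BExt.cls M :=
    Quotient.sound (isIso_ofHom_comp
      (CrossedExt.pushforwardHom (B' := X'.B) X φ.f φ.equivariant) M (G.outer φ)
      (MonoidHom.id _) (fun _ => rfl) (fun _ => rfl) (fun _ => rfl) (fun _ => rfl))
  rw [h₁, h₂]

/-- A butterfly `X → X'` over `φ` factors as a butterfly `φ_* X → φ^* X'` with the same group. -/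
noncomputable def inner (F : Butterfly X X')
    (h₀ : ∀ e, φ.f₀ (X.p (F.δ e)) = X'.p (F.γ e))
    (h : ∀ b : X.B, F.κ (X.j b) * F.ι (X'.j (φ.f b)) = 1) :
    Butterfly (lowerStar φ) (upperStar φ) where
  E := F.E
  -- The inverse on the `B'` factor is forced by the convention `κ (j b) * ι (j' (φ b)) = 1`, and it
  -- is what makes the map trivial on the relations. It is multiplicative since the images of `κ`
  -- and `ι` commute.
  κ := QuotientGroup.lift _
    (MonoidHom.mk' (fun t : X'.B × X.G₂ => (F.ι (X'.j t.1))⁻¹ * F.κ t.2) fun s t => by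
      show (F.ι (X'.j (s.1 * t.1)))⁻¹ * F.κ (s.2 * t.2) =
        (F.ι (X'.j s.1))⁻¹ * F.κ s.2 * ((F.ι (X'.j t.1))⁻¹ * F.κ t.2)
      have hc := F.κι_comm s.2 (X'.j t.1)⁻¹
      rw [map_inv] at hc
      rw [mul_comm s.1, map_mul, map_mul, map_mul, mul_inv_rev, mul_assoc, mul_assoc,
        ← mul_assoc (F.κ s.2), hc, mul_assoc]) (by
      rintro _ ⟨b, rfl⟩
      show (F.ι (X'.j (φ.f b)))⁻¹ * F.κ (X.j b)⁻¹ = 1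
      rw [map_inv, ← mul_inv_rev, h, inv_one])
  ι := F.ι
  δ := F.δ
  γ := (F.γ.prod (X.p.comp F.δ)).codRestrict (CrossedExt.pullbackG₁ (C := X.C) X' φ.f₀)
    fun e => (h₀ e).symm
  δκ q := by
    obtain ⟨⟨b', x⟩, rfl⟩ := lowerStarMk_surjective φ q
    show F.δ ((F.ι (X'.j b'))⁻¹ * F.κ x) = X.bd x
    rw [map_mul, map_inv, F.δι, F.δκ, inv_one, one_mul]
  γι g := by
    refine Subtype.ext (Prod.ext (F.γι g) ?_)
    exact (congrArg X.p (F.δι g)).trans (map_one _)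
  γκ q := by
    obtain ⟨⟨b', x⟩, rfl⟩ := lowerStarMk_surjective φ q
    refine Subtype.ext (Prod.ext ?_ ?_)
    · show F.γ ((F.ι (X'.j b'))⁻¹ * F.κ x) = 1
      rw [map_mul, map_inv, F.γι, F.γκ, X'.bd_j, inv_one, one_mul]
    · show X.p (F.δ ((F.ι (X'.j b'))⁻¹ * F.κ x)) = 1
      rw [map_mul, map_inv, F.δι, F.δκ, inv_one, one_mul, X.p_bd]
  ι_injective := F.ι_injective
  δ_surjective := F.δ_surjective
  exact := F.exact
  κ_smul e q := by
    obtain ⟨⟨b', x⟩, rfl⟩ := lowerStarMk_surjective φ q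
    show (F.ι (X'.j (φ.f₀ (X.p (F.δ e)) • b')))⁻¹ * F.κ (F.δ e • x) =
      e * ((F.ι (X'.j b'))⁻¹ * F.κ x) * e⁻¹
    -- Now `B'` is acted on through `p' (γ e)`, so the action becomes conjugation by `e` under `ι`.
    rw [h₀]
    erw [X'.j_smul]
    rw [F.ι_smul, F.κ_smul]
    group
  ι_smul e g := F.ι_smul e g

theorem cls_outer_inner (F : Butterfly X X')
    (h₀ : ∀ e, φ.f₀ (X.p (F.δ e)) = X'.p (F.γ e))
    (h : ∀ b : X.B, F.κ (X.j b) * F.ι (X'.j (φ.f b)) = 1) :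
    BExt.cls ((F.inner φ h₀ h).outer φ) = BExt.cls F := by
  refine Quotient.sound ⟨MulEquiv.refl _, fun x => ?_, fun _ => rfl, fun _ => rfl, fun _ => rfl⟩
  show (F.ι (X'.j 1))⁻¹ * F.κ x = F.κ x
  rw [map_one, map_one, inv_one, one_mul]

theorem isHomLift_cls_inner (F : Butterfly X X')
    (h₀ : ∀ e, φ.f₀ (X.p (F.δ e)) = X'.p (F.γ e))
    (h : ∀ b : X.B, F.κ (X.j b) * F.ι (X'.j (φ.f b)) = 1) :
    P.IsHomLift (𝟙 (P.obj (upperStar φ))) (BExt.cls (F.inner φ h₀ h)) := by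
  refine (isHomLift_cls_iff φ _).2 ⟨fun e => rfl, fun b' => ?_⟩
  show (F.ι (X'.j b'))⁻¹ * F.κ 1 * F.ι (X'.j b') = 1
  rw [map_one, mul_one, inv_mul_cancel]

/-- The condition on `B` holds because `(1, j b)` and `(φ b, 1)` have the same class in `B' ×^B G₂`;
the condition on `C` is membership of `γ e` in the fibre product. -/
theorem P_map_cls_outer (G : Butterfly (lowerStar φ) (upperStar φ))
    (hG : P.IsHomLift (𝟙 (P.obj (upperStar φ))) (BExt.cls G)) :
    P.map (BExt.cls (G.outer φ)) = φ := by
  obtain ⟨h₀, h⟩ := (isHomLift_cls_iff φ G).1 hG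
  refine ((G.outer φ).P_map_cls_eq_iff φ).2 ⟨fun e => ?_, fun b => ?_⟩
  · exact (congrArg φ.f₀ (h₀ e)).trans (G.γ e).2.symm
  · refine Eq.trans ?_ (h (φ.f b))
    refine congrArg (fun t => G.κ t * G.ι (X'.j (φ.f b))) ?_
    -- The relation at `b` is `(φ b, (j b)⁻¹)`, and `(1, j b)` times it is `(φ b, 1)`.
    refine (QuotientGroup.mk'_eq_mk' _).2 ⟨_, ⟨b, rfl⟩, Prod.ext ?_ ?_⟩
    · exact one_mul _
    · exact mul_inv_cancel _

/-- `outer` forgets only `κ` on `B'` and the `C`-component of `γ`. In the fibre these are recovered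
from `ι` and from `p δ`, so the given isomorphism of groups respects them too. -/
theorem isIso_of_outer (G G' : Butterfly (lowerStar φ) (upperStar φ))
    (hG : P.IsHomLift (𝟙 (P.obj (upperStar φ))) (BExt.cls G))
    (hG' : P.IsHomLift (𝟙 (P.obj (upperStar φ))) (BExt.cls G'))
    (h : IsIso (G.outer φ) (G'.outer φ)) : IsIso G G' := by
  obtain ⟨h₀, hκ⟩ := (isHomLift_cls_iff φ G).1 hG
  obtain ⟨h₀', hκ'⟩ := (isHomLift_cls_iff φ G').1 hG'
  obtain ⟨α, h1, h2, h3, h4⟩ := h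
  refine ⟨α, fun q => ?_, h2, h3, fun e => ?_⟩
  · obtain ⟨⟨b', x⟩, rfl⟩ := lowerStarMk_surjective φ q
    have hx : α (G.κ (lowerStarMk φ (1, x))) = G'.κ (lowerStarMk φ (1, x)) := h1 x
    have hb : α (G.κ (lowerStarMk φ (b', 1))) = G'.κ (lowerStarMk φ (b', 1)) := by
      have h5 : α (G.ι (X'.j b')) = G'.ι (X'.j b') := h2 _
      have h6 := eq_inv_of_mul_eq_one_left (hκ b')
      have h7 := eq_inv_of_mul_eq_one_left (hκ' b')
      refine (congrArg α h6).trans (Eq.trans ?_ h7.symm)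
      exact (map_inv α _).trans (congrArg _ h5)
    have hq : (b', x) = (b', 1) * (1, x) := by simp
    rw [hq, map_mul, map_mul, map_mul, ← hx, ← hb]
    exact map_mul α _ _
  · refine Subtype.ext (Prod.ext (h4 e) ?_)
    exact (h₀' (α e)).symm.trans ((congrArg X.p (h3 e)).trans (h₀ e))

end Butterfly

/-- The morphisms `φ_* X → φ^* X'` of the fibre correspond to the morphisms `X → X'` over `φ`. -/
noncomputable def fibreHomEquiv :
    (lowerStarFib φ ⟶ upperStarFib φ) ≃ {f : X ⟶ X' // P.map f = φ} :=
  Equiv.ofBijective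
    (fun g => ⟨toLowerStar φ ≫ g.1 ≫ fromUpperStar φ, by
      obtain ⟨G, hG⟩ := g
      induction G using Quotient.inductionOn with
      | h G => exact (congrArg P.map (G.cls_outer φ).symm).trans (G.P_map_cls_outer φ hG)⟩)
    (by
      constructor
      · rintro ⟨G, hG⟩ ⟨G', hG'⟩ h
        induction G using Quotient.inductionOn with
        | h G =>
          induction G' using Quotient.inductionOn with
          | h G' =>
            have h' : toLowerStar φ ≫ BExt.cls G ≫ fromUpperStar φ =
              toLowerStar φ ≫ BExt.cls G' ≫ fromUpperStar φ := congrArg Subtype.val h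
            replace h' := (G.cls_outer φ).trans (h'.trans (G'.cls_outer φ).symm)
            exact Subtype.ext (Quotient.sound (G.isIso_of_outer φ G' hG hG' (Quotient.exact h')))
      · rintro ⟨F, hF⟩
        induction F using Quotient.inductionOn with
        | h F =>
          obtain ⟨h₀, h⟩ := (F.P_map_cls_eq_iff φ).1 hF
          exact ⟨⟨BExt.cls (F.inner φ h₀ h), F.isHomLift_cls_inner φ h₀ h⟩, Subtype.ext
            (((F.inner φ h₀ h).cls_outer φ).symm.trans (F.cls_outer_inner φ h₀ h))⟩)

/-- Such a butterfly induces the identity on `C` and on `B'`, hence is flippable. The inverse of its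
class again lies over the identity, so it is an inverse inside the fibre. -/
instance isIso_fibreHom (g : lowerStarFib φ ⟶ upperStarFib φ) : IsIso g := by
  obtain ⟨G, hG⟩ := g
  induction G using Quotient.inductionOn with
  | h G =>
    obtain ⟨h₀, h⟩ := (isHomLift_cls_iff φ G).1 hG
    have hb₀ (c : X.C) : G.base c = c := by
      obtain ⟨g, rfl⟩ := X.p_surjective c
      obtain ⟨e, rfl⟩ := G.δ_surjective g
      exact (G.base_eq e).trans (h₀ e).symm
    have hb (b : X'.B) : G.fibre b = b := G.fibre_unique (b := b) (G.fibre_eq b) (h b)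
    have : IsIso (BExt.cls G) := BExt.isIso_cls G (G.flippable_of_bijective
      ⟨fun c d hcd => (hb₀ c).symm.trans (hcd.trans (hb₀ d)), fun c => ⟨c, hb₀ c⟩⟩
      ⟨fun b b' hbb => (hb b).symm.trans (hbb.trans (hb b')), fun b => ⟨b, hb b⟩⟩)
    have : P.IsHomLift (𝟙 (P.obj (upperStar φ))) (BExt.cls G) := hG
    exact ⟨⟨inv (BExt.cls G), IsHomLift.lift_id_inv_isIso P _ _⟩, Subtype.ext (IsIso.hom_inv_id (BExt.cls G)),
      Subtype.ext (IsIso.inv_hom_id (BExt.cls G))⟩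

end fibre

end XExt

/-! ### Existence criterion and torsor structure. -/

theorem theorem6p7 (X X' : XExt.BExt.{u}) (φ : X.toMod ⟶ X'.toMod) :
    ((∃ f : X ⟶ X', XExt.P.map f = φ) ↔
      Nonempty (XExt.upperStarFib φ ≅ XExt.lowerStarFib φ)) ∧
    ((∃ f : X ⟶ X', XExt.P.map f = φ) →
      ∃ _ : MulAction (Aut (XExt.upperStarFib φ)) {f : X ⟶ X' // XExt.P.map f = φ},
        (∀ s t : {f : X ⟶ X' // XExt.P.map f = φ},
          ∃! a : Aut (XExt.upperStarFib φ), a • s = t) ∧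
        (∀ (a : Aut (XExt.upperStarFib φ))
          (g : XExt.lowerStarFib φ ⟶ XExt.upperStarFib φ)
          (s : {f : X ⟶ X' // XExt.P.map f = φ}),
          s.1 = XExt.toLowerStar φ ≫ g.1 ≫ XExt.fromUpperStar φ →
          (a • s).1 = XExt.toLowerStar φ ≫ (g ≫ a.hom).1 ≫ XExt.fromUpperStar φ)) := by
  let T := XExt.fibreHomEquiv φ
  refine ⟨⟨fun ⟨f, hf⟩ => ⟨(asIso (T.symm ⟨f, hf⟩)).symm⟩,
    fun ⟨i⟩ => ⟨(T i.inv).1, (T i.inv).2⟩⟩, fun _ => ?_⟩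
  refine ⟨{
    -- Multiplication in `Aut` is composition from right to left, so postcomposition is a left
    -- action.
    smul := fun (a : Aut (XExt.upperStarFib φ)) (s : {f : X ⟶ X' // XExt.P.map f = φ}) =>
      T (T.symm s ≫ a.hom)
    one_smul := fun s => ?_
    mul_smul := fun a b s => ?_ }, ?_, ?_⟩
  · show T (T.symm s ≫ b.hom ≫ a.hom) = T (T.symm (T (T.symm s ≫ b.hom)) ≫ a.hom)
    rw [T.symm_apply_apply, Category.assoc]
  · show T (T.symm s ≫ 𝟙 _) = s
    rw [Category.comp_id, T.apply_symm_apply]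
  · intro s t
    -- As `T.symm s` is invertible, `T.symm s ≫ a.hom = T.symm t` has exactly one solution.
    refine ⟨(asIso (T.symm s)).symm ≪≫ asIso (T.symm t), ?_, fun a ha => ?_⟩
    · show T (T.symm s ≫ inv (T.symm s) ≫ T.symm t) = t
      rw [IsIso.hom_inv_id_assoc, T.apply_symm_apply]
    · have ha : T (T.symm s ≫ a.hom) = t := ha
      apply Iso.ext
      show a.hom = inv (T.symm s) ≫ T.symm t
      rw [← ha, T.symm_apply_apply, IsIso.inv_hom_id_assoc]
  · intro a g s hs
    obtain rfl : s = T g := Subtype.ext hs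
    show (T (T.symm (T g) ≫ a.hom)).1 = _
    rw [T.symm_apply_apply]
    rfl
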